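/- Let $L^2(0,1)$ be the real Hilbert space of square-integrable real functions on $(0,1)$ with Lebesgue measure. For an orthonormal system $\Phi=\{\phi_j\}_{j\in\mathbb N}\subset L^2(0,1)$ and an integer $n\ge 1$ put $$\kappa_n(\Phi)=\sup\frac{\bigl\|\max_{1\le m\le n}|p_m|\bigr\|_{2}}{\|p_n\|_{2}}\in[0,\infty],$$ where the supremum is over all sequences $p_k=\sum_{j\in G_k}c_j\phi_j$, $k=1,\dots,n$, with finite sets $G_1\subset G_2\subset\dots\subset G_n\subset\mathbb N$ and real numbers $c_j$ such that $\sum_{j\in G_n}c_j^2\ne 0$. Then there is an absolute constant $C>0$ such that for every complete orthonormal system $\Phi$ in $L^2(0,1)$ (that is, every orthonormal sequence whose linear span is dense in $L^2(0,1)$) and every integer $n\ge 1$, $$\kappa_n(\Phi)\ \ge\ C\,\sqrt{\log_2 n}.$$ -/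

import Mathlib

open MeasureTheory
open scoped ENNReal

/-- Lebesgue measure on the interval `(0,1)`. -/
noncomputable abbrev muUnit : Measure ℝ := volume.restrict (Set.Ioo (0 : ℝ) 1)

/-- The real Hilbert space `L²(0,1)`. -/
abbrev L2Unit : Type := Lp ℝ 2 muUnit

/-- A complete orthonormal system in `L²(0,1)`: an orthonormal sequence whose finite linear
combinations are dense. -/
structure IsCompleteOrthonormalSystem (Φ : ℕ → L2Unit) : Prop where
  orthonormal : Orthonormal ℝ Φ
  complete : (Submodule.span ℝ (Set.range Φ)).topologicalClosure = ⊤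

/-- The `Φ`-polynomial `∑_{j ∈ G} c_j φ_j` with finite index set `G`. -/
noncomputable def phiPolynomial (Φ : ℕ → L2Unit) (c : ℕ → ℝ) (G : Finset ℕ) : L2Unit :=
  ∑ j ∈ G, c j • Φ j

/-- The maximal function `x ↦ max_{1 ≤ m ≤ n} |p_m(x)|`, with values in `[0,∞]`. -/
noncomputable def maximalFunction (n : ℕ) (p : ℕ → L2Unit) (x : ℝ) : ℝ≥0∞ :=
  ⨆ m ∈ Finset.Icc 1 n, ‖p m x‖ₑ

/-- The pairs `(G, c)` that define the monotonic sequences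
`p_k = ∑_{j ∈ G_k} c_j φ_j`, `1 ≤ k ≤ n`: the finite sets satisfy `G_1 ⊆ ⋯ ⊆ G_n`, and
`∑_{j ∈ G_n} c_j² ≠ 0`. Only the values `G 1, …, G n` are used. -/
def IsMonotonicData (n : ℕ) (G : ℕ → Finset ℕ) (c : ℕ → ℝ) : Prop :=
  MonotoneOn G (Set.Icc 1 n) ∧ ∑ j ∈ G n, c j ^ 2 ≠ 0

/-- `κ_n(Φ)`: the supremum, in `[0,∞]`, of `‖max_{1 ≤ m ≤ n} |p_m|‖₂ / ‖p_n‖₂` over all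
monotonic sequences `p_1, …, p_n` of `Φ`-polynomials. -/
noncomputable def kappa (n : ℕ) (Φ : ℕ → L2Unit) : ℝ≥0∞ :=
  ⨆ (G : ℕ → Finset ℕ) (c : ℕ → ℝ) (_ : IsMonotonicData n G c),
    eLpNorm (maximalFunction n fun k => phiPolynomial Φ c (G k)) 2 muUnit /
      eLpNorm (phiPolynomial Φ c (G n)) 2 muUnit

/-! For n = 2^k, a branching construction makes the maximum large and the final sum small. Split a
set E by a fast oscillating sign r into E₁ = {r = -1} and E₂ = {r = 1}. Run the construction on E₁,
add r on E, then run it on E₂. Points of E₁ attain their maximum before the -1 arrives, points of E₂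
after the +1, so each level raises the mean of the maximum by about |E|/2. The final sum behaves
like a sum of k orthogonal signs, with L² norm about √k. The ratio is thus of order k/√k = √k.
Completeness makes this possible in any system: Rademacher functions tend weakly to zero, so a late
one is nearly orthogonal to the finitely many members already used and is approximated by a
polynomial in the others (`exists_sign_near`). The recursion is `exists_isSpreadSequence`;
`le_kappa` reads off the bound. -/

/-! ### Rademacher functions and their weak convergence to zero -/

/-- The `M`-th Rademacher function, as a `1`-periodic function on the real line. -/
noncomputable def rademacher (M : ℕ) (x : ℝ) : ℝ :=
  if Int.fract (2 ^ M * x) < 1 / 2 then 1 else -1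

lemma measurable_rademacher (M : ℕ) : Measurable (rademacher M) := by
  unfold rademacher
  refine Measurable.ite ?_ measurable_const measurable_const
  exact measurableSet_lt (by fun_prop) measurable_const

lemma rademacher_eq_or (M : ℕ) (x : ℝ) : rademacher M x = 1 ∨ rademacher M x = -1 := by
  unfold rademacher; split_ifs <;> simp

lemma abs_rademacher (M : ℕ) (x : ℝ) : |rademacher M x| = 1 := by
  rcases rademacher_eq_or M x with h | h <;> simp [h]

lemma rademacher_mul_self (M : ℕ) (x : ℝ) : rademacher M x * rademacher M x = 1 := by
  rcases rademacher_eq_or M x with h | h <;> simp [h]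

lemma rademacher_periodic (M : ℕ) : Function.Periodic (rademacher M) 1 := by
  intro x
  have h : (2 : ℝ) ^ M * (x + 1) = 2 ^ M * x + ((2 ^ M : ℕ) : ℝ) := by push_cast; ring
  simp only [rademacher, h, Int.fract_add_natCast]

lemma rademacher_add_of_lt {M K : ℕ} (h : M < K) (x : ℝ) :
    rademacher K (x + 1 / 2 ^ (M + 1)) = rademacher K x := by
  obtain ⟨d, rfl⟩ := Nat.exists_eq_add_of_lt h
  have h : (2 : ℝ) ^ (M + d + 1) * (x + 1 / 2 ^ (M + 1))
      = 2 ^ (M + d + 1) * x + ((2 ^ d : ℕ) : ℝ) := by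
    push_cast; field_simp; ring
  simp only [rademacher, h, Int.fract_add_natCast]

lemma rademacher_add_self (M : ℕ) (x : ℝ) :
    rademacher M (x + 1 / 2 ^ (M + 1)) = -rademacher M x := by
  have h : (2 : ℝ) ^ M * (x + 1 / 2 ^ (M + 1)) = 2 ^ M * x + 1 / 2 := by
    field_simp; ring
  simp only [rademacher, h]
  set y := (2 : ℝ) ^ M * x
  have h0 := Int.fract_nonneg y
  have h1 := Int.fract_lt_one y
  have hy := Int.floor_add_fract y
  by_cases hlt : Int.fract y < 1 / 2
  · have : Int.fract (y + 1 / 2) = Int.fract y + 1 / 2 := by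
      rw [Int.fract_eq_iff]
      exact ⟨by linarith, by linarith, ⌊y⌋, by linarith⟩
    rw [this, if_pos hlt, if_neg (by linarith)]
  · push Not at hlt
    have : Int.fract (y + 1 / 2) = Int.fract y - 1 / 2 := by
      rw [Int.fract_eq_iff]
      exact ⟨by linarith, by linarith, ⌊y⌋ + 1, by push_cast; linarith⟩
    rw [this, if_pos (by linarith), if_neg (by linarith), neg_neg]

instance : IsProbabilityMeasure muUnit := ⟨by simp [muUnit]⟩

/-- Translation by half a period of the slower factor flips its sign and fixes the faster one, so
the integral over a period equals its own negative. -/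
lemma integral_rademacher_mul_of_lt {M K : ℕ} (h : M < K) :
    ∫ x, rademacher M x * rademacher K x ∂muUnit = 0 := by
  set f : ℝ → ℝ := fun x => rademacher M x * rademacher K x
  have hper : Function.Periodic f 1 := fun x => by
    simp only [f, rademacher_periodic M x, rademacher_periodic K x]
  have hanti : ∀ x, f (x + 1 / 2 ^ (M + 1)) = -f x := fun x => by
    simp only [f, rademacher_add_self, rademacher_add_of_lt h, neg_mul]
  have h1 : ∫ x in (0 : ℝ)..1, f x = -∫ x in (0 : ℝ)..1, f x := by
    calc ∫ x in (0 : ℝ)..1, f x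
        = ∫ x in (0 + 1 / 2 ^ (M + 1) : ℝ)..(1 + 1 / 2 ^ (M + 1)), f x := by
          have := hper.intervalIntegral_add_eq 0 (1 / 2 ^ (M + 1))
          rw [zero_add] at this ⊢
          rw [this, add_comm (1 : ℝ)]
      _ = ∫ x in (0 : ℝ)..1, f (x + 1 / 2 ^ (M + 1)) := by
          rw [intervalIntegral.integral_comp_add_right]
      _ = -∫ x in (0 : ℝ)..1, f x := by
          simp only [hanti, intervalIntegral.integral_neg]
  have h2 : ∫ x in (0 : ℝ)..1, f x = 0 := by linarith
  rwa [intervalIntegral.integral_of_le zero_le_one, integral_Ioc_eq_integral_Ioo] at h2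

lemma memLp_rademacher (M : ℕ) : MemLp (rademacher M) 2 muUnit :=
  MemLp.of_bound (measurable_rademacher M).aestronglyMeasurable 1
    (Filter.Eventually.of_forall fun x => by simp [abs_rademacher])

lemma inner_toLp_toLp {f g : ℝ → ℝ} (hf : MemLp f 2 muUnit) (hg : MemLp g 2 muUnit) :
    inner ℝ (hf.toLp f) (hg.toLp g) = ∫ x, f x * g x ∂muUnit := by
  rw [L2.inner_def]
  refine integral_congr_ae ?_
  filter_upwards [hf.coeFn_toLp, hg.coeFn_toLp] with x h1 h2
  rw [h1, h2]
  simp [mul_comm]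

lemma orthonormal_rademacher :
    Orthonormal ℝ fun M => (memLp_rademacher M).toLp (rademacher M) := by
  rw [orthonormal_iff_ite]
  intro M K
  rw [inner_toLp_toLp]
  rcases lt_trichotomy M K with h | rfl | h
  · rw [if_neg h.ne, integral_rademacher_mul_of_lt h]
  · simp [rademacher_mul_self]
  · rw [if_neg h.ne', ← integral_rademacher_mul_of_lt h]
    simp only [mul_comm]

/-- By Bessel's inequality the squares of these coefficients are summable. -/
lemma tendsto_integral_rademacher_mul {g : ℝ → ℝ} (hg : MemLp g 2 muUnit) :
    Filter.Tendsto (fun M => ∫ x, rademacher M x * g x ∂muUnit) Filter.atTop (nhds 0) := by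
  have h := (orthonormal_rademacher.inner_products_summable (hg.toLp g)).tendsto_atTop_zero
  simp only [inner_toLp_toLp, Real.norm_eq_abs, sq_abs] at h
  have h' := h.sqrt
  simp only [Real.sqrt_sq_eq_abs, Real.sqrt_zero] at h'
  exact (tendsto_zero_iff_abs_tendsto_zero _).2 h'

/-! ### Approximation with a forbidden finite spectrum -/

/-- A vector almost orthogonal to finitely many members of a complete orthonormal system is
approximated by polynomials which avoid those members. -/
lemma IsCompleteOrthonormalSystem.exists_phiPolynomial_near {Φ : ℕ → L2Unit}
    (hΦ : IsCompleteOrthonormalSystem Φ) (h : L2Unit) (F : Finset ℕ) {ε : ℝ} (hε : 0 < ε)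
    (hF : ∑ j ∈ F, |inner ℝ (Φ j) h| ≤ ε / 2) :
    ∃ (B : Finset ℕ) (b : ℕ → ℝ), Disjoint B F ∧ ‖phiPolynomial Φ b B - h‖ ≤ ε := by
  let v := HilbertBasis.mk hΦ.orthonormal hΦ.complete.ge
  have hv : ∀ j, v j = Φ j := fun j => by simp [v]
  have hs := v.hasSum_repr h
  simp only [v.repr_apply_apply, hv] at hs
  have h1 := (Metric.tendsto_nhds.1 hs (ε / 2) (by positivity)).and
    (Filter.eventually_ge_atTop F)
  obtain ⟨s, hs1, hs2⟩ := h1.exists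
  -- A partial sum of the expansion of `h` with the terms in `F` deleted: truncation and deletion
  -- cost ε/2 each.
  refine ⟨s \ F, fun j => inner ℝ (Φ j) h, Finset.sdiff_disjoint, ?_⟩
  have h2 := Finset.sum_sdiff (f := fun j => (inner ℝ (Φ j) h : ℝ) • Φ j) hs2
  have h3 : ‖∑ j ∈ F, (inner ℝ (Φ j) h : ℝ) • Φ j‖ ≤ ε / 2 := by
    refine (norm_sum_le _ _).trans (le_trans (Finset.sum_le_sum fun j _ => ?_) hF)
    rw [norm_smul, hΦ.orthonormal.1 j, mul_one, Real.norm_eq_abs]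
  rw [dist_eq_norm] at hs1
  have h4 : phiPolynomial Φ (fun j => inner ℝ (Φ j) h) (s \ F) - h
      = (∑ j ∈ s, (inner ℝ (Φ j) h : ℝ) • Φ j - h)
        - ∑ j ∈ F, (inner ℝ (Φ j) h : ℝ) • Φ j := by
    rw [← h2, phiPolynomial]; abel
  rw [h4]
  exact (norm_sub_le _ _).trans (by linarith)

/-- A measurable set carries a sign function, almost balanced on the set, which is approximated by
polynomials avoiding a given finite part of the spectrum. -/
lemma IsCompleteOrthonormalSystem.exists_sign_near {Φ : ℕ → L2Unit}
    (hΦ : IsCompleteOrthonormalSystem Φ) {E : Set ℝ} (hE : MeasurableSet E) (F : Finset ℕ)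
    {ε : ℝ} (hε : 0 < ε) :
    ∃ (r : ℝ → ℝ) (hr : MemLp (E.indicator r) 2 muUnit) (B : Finset ℕ) (b : ℕ → ℝ),
      Measurable r ∧ (∀ x, r x = 1 ∨ r x = -1) ∧ |∫ x, E.indicator r x ∂muUnit| ≤ ε ∧
      Disjoint B F ∧ ‖phiPolynomial Φ b B - hr.toLp _‖ ≤ ε := by
  have hmem : ∀ M, MemLp (E.indicator (rademacher M)) 2 muUnit :=
    fun M => (memLp_rademacher M).indicator hE
  have hind : ∀ (M : ℕ) (g : ℝ → ℝ) (x : ℝ),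
      rademacher M x * E.indicator g x = g x * E.indicator (rademacher M) x := fun M g x => by
    by_cases hx : x ∈ E <;> simp [hx, mul_comm]
  have h1 := tendsto_integral_rademacher_mul ((memLp_const (1 : ℝ)).indicator hE)
  simp only [hind, one_mul] at h1
  have h2 : Filter.Tendsto (fun M => ∑ j ∈ F, |inner ℝ (Φ j) ((hmem M).toLp _)|)
      Filter.atTop (nhds 0) := by
    have h0 : ∑ j ∈ F, (0 : ℝ) = 0 := Finset.sum_const_zero
    refine h0 ▸ tendsto_finsetSum _ fun j _ => ?_
    have h := tendsto_integral_rademacher_mul ((Lp.memLp (Φ j)).indicator hE)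
    simp only [hind] at h
    have h' := h.abs
    rw [abs_zero] at h'
    refine h'.congr fun M => ?_
    rw [← inner_toLp_toLp (Lp.memLp (Φ j)) (hmem M), Lp.toLp_coeFn]
  have h1' := h1.abs
  rw [abs_zero] at h1'
  obtain ⟨M, hM1, hM2⟩ := ((h1'.eventually_le_const hε).and
    (h2.eventually_le_const (half_pos hε))).exists
  obtain ⟨B, b, hB, hb⟩ := hΦ.exists_phiPolynomial_near _ F hε hM2
  exact ⟨rademacher M, hmem M, B, b, measurable_rademacher M, rademacher_eq_or M, hM1, hB, hb⟩

/-! ### The recursive construction -/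

/-- A monotonic sequence of polynomials `∑_{j ∈ G m} c_j φ_j`, `m < 2 ^ k`, whose spectrum avoids
`F` and which is `ε`-close to functions `S m` supported in `E`. The last of them has mean square
about `k` on `E`, while the maximum of all of them dominates a function `T` with mean value about
`k / 2` on `E`. -/
structure IsSpreadSequence (Φ : ℕ → L2Unit) (E : Set ℝ) (F : Finset ℕ) (k : ℕ) (ε : ℝ)
    (G : ℕ → Finset ℕ) (c : ℕ → ℝ) (S : ℕ → ℝ → ℝ) (T : ℝ → ℝ) : Prop where
  monotone : Monotone G
  disjoint : ∀ m, Disjoint (G m) F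
  memLp : ∀ m, MemLp (S m) 2 muUnit
  near : ∀ m, ‖phiPolynomial Φ c (G m) - (memLp m).toLp (S m)‖ ≤ ε
  eq_zero : ∀ m, ∀ x ∉ E, S m x = 0
  integrable : Integrable T muUnit
  eq_zero' : ∀ x ∉ E, T x = 0
  le : ∀ x ∈ E, ∃ m < 2 ^ k, T x ≤ S m x
  le_integral : k / 2 * muUnit.real E - ε ≤ ∫ x, T x ∂muUnit
  abs_integral_le : |∫ x, S (2 ^ k - 1) x ∂muUnit| ≤ ε
  integral_sq_le : ∫ x, S (2 ^ k - 1) x ^ 2 ∂muUnit ≤ k * muUnit.real E + ε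

lemma phiPolynomial_union {Φ : ℕ → L2Unit} {c : ℕ → ℝ} {A B : Finset ℕ} (h : Disjoint A B) :
    phiPolynomial Φ c (A ∪ B) = phiPolynomial Φ c A + phiPolynomial Φ c B :=
  Finset.sum_union h

lemma phiPolynomial_congr {Φ : ℕ → L2Unit} {c d : ℕ → ℝ} {A : Finset ℕ}
    (h : ∀ j ∈ A, c j = d j) : phiPolynomial Φ c A = phiPolynomial Φ d A :=
  Finset.sum_congr rfl fun j hj => by rw [h j hj]

lemma isSpreadSequence_zero (Φ : ℕ → L2Unit) (E : Set ℝ) (F : Finset ℕ) {ε : ℝ} (hε : 0 < ε) :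
    IsSpreadSequence Φ E F 0 ε (fun _ => ∅) 0 0 0 where
  monotone := monotone_const
  disjoint := by simp
  memLp _ := MemLp.zero
  near _ := by simpa [phiPolynomial] using hε.le
  eq_zero := by simp
  integrable := integrable_zero _ _ _
  eq_zero' := by simp
  le x _ := ⟨0, by simp⟩
  le_integral := by simpa using hε.le
  abs_integral_le := by simpa using hε.le
  integral_sq_le := by simpa using hε.le

theorem IsCompleteOrthonormalSystem.exists_isSpreadSequence {Φ : ℕ → L2Unit}
    (hΦ : IsCompleteOrthonormalSystem Φ) (k : ℕ) :
    ∀ {E : Set ℝ}, MeasurableSet E → ∀ (F : Finset ℕ) {ε : ℝ}, 0 < ε →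
      ∃ G c S T, IsSpreadSequence Φ E F k ε G c S T := by
  induction k with
  | zero => exact fun _ F ε hε => ⟨_, _, _, _, isSpreadSequence_zero Φ _ F hε⟩
  | succ k ih =>
    intro E hE F ε hε
    -- The value ε/6 is dictated by the mean square: two errors from the squares and four from the
    -- doubled integrals of `S₁` and `S₂`.
    obtain ⟨r, hr, B, b, hrm, hr1, hint, hBF, hb⟩ :=
      hΦ.exists_sign_near hE F (ε := ε / 6) (by positivity)
    set E₁ : Set ℝ := E ∩ {x | r x = -1}
    set E₂ : Set ℝ := E ∩ {x | r x = 1}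
    have hE₁ : MeasurableSet E₁ := hE.inter (hrm (measurableSet_singleton _))
    have hE₂ : MeasurableSet E₂ := hE.inter (hrm (measurableSet_singleton _))
    obtain ⟨G₁, c₁, S₁, T₁, h₁⟩ := ih hE₁ (F ∪ B) (ε := ε / 6) (by positivity)
    -- Avoiding the whole earlier spectrum lets one coefficient sequence `c` serve all three pieces.
    obtain ⟨G₂, c₂, S₂, T₂, h₂⟩ :=
      ih hE₂ (F ∪ B ∪ G₁ (2 ^ k - 1)) (ε := ε / 6) (by positivity)
    set N := 2 ^ k
    have hN : 0 < N := by positivity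
    have hN2 : 2 ^ (k + 1) = 2 * N := pow_succ' 2 k
    have hcase : ∀ x, x ∉ E ∧ x ∉ E₁ ∧ x ∉ E₂ ∨ x ∈ E ∧ x ∈ E₁ ∧ x ∉ E₂ ∧ r x = -1 ∨
        x ∈ E ∧ x ∉ E₁ ∧ x ∈ E₂ ∧ r x = 1 := by
      intro x
      by_cases hx : x ∈ E
      · rcases hr1 x with h | h
        · refine Or.inr (Or.inr ⟨hx, fun h' => ?_, ⟨hx, h⟩, h⟩)
          have := h'.2
          simp only [Set.mem_ofPred_eq] at this
          linarith
        · refine Or.inr (Or.inl ⟨hx, ⟨hx, h⟩, fun h' => ?_, h⟩)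
          have := h'.2
          simp only [Set.mem_ofPred_eq] at this
          linarith
      · exact Or.inl ⟨hx, fun h => hx h.1, fun h => hx h.1⟩
    have hone : ∀ {A : Set ℝ}, MeasurableSet A → Integrable (A.indicator (1 : ℝ → ℝ)) muUnit :=
      fun hA => (integrable_const 1).indicator hA
    have hri : Integrable (E.indicator r) muUnit := hr.integrable one_le_two
    have hsum : muUnit.real E₁ + muUnit.real E₂ = muUnit.real E := by
      rw [← integral_indicator_one hE₁, ← integral_indicator_one hE₂, ← integral_indicator_one hE,
        ← integral_add (hone hE₁) (hone hE₂)]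
      congr 1 with x
      rcases hcase x with ⟨a, b, c⟩ | ⟨a, b, c, d⟩ | ⟨a, b, c, d⟩ <;> simp [a, b, c]
    have hdiff : muUnit.real E₂ - muUnit.real E₁ = ∫ x, E.indicator r x ∂muUnit := by
      rw [← integral_indicator_one hE₁, ← integral_indicator_one hE₂,
        ← integral_sub (hone hE₂) (hone hE₁)]
      congr 1 with x
      rcases hcase x with ⟨a, b, c⟩ | ⟨a, b, c, d⟩ | ⟨a, b, c, d⟩ <;> simp [*]
    have hG₁ : ∀ m, Disjoint (G₁ m) F ∧ Disjoint (G₁ m) B := fun m =>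
      Finset.disjoint_union_right.1 (h₁.disjoint m)
    have hG₂ : ∀ m, (Disjoint (G₂ m) F ∧ Disjoint (G₂ m) B) ∧ Disjoint (G₂ m) (G₁ (N - 1)) :=
      fun m => by
        have h := Finset.disjoint_union_right.1 (h₂.disjoint m)
        exact ⟨Finset.disjoint_union_right.1 h.1, h.2⟩
    set G : ℕ → Finset ℕ := fun m => if m < N then G₁ m else G₁ (N - 1) ∪ B ∪ G₂ (m - N) with hG
    set c : ℕ → ℝ := fun j => if j ∈ G₁ (N - 1) then c₁ j else if j ∈ B then b j else c₂ j with hc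
    set S : ℕ → ℝ → ℝ := fun m => if m < N then S₁ m else S₁ (N - 1) + E.indicator r + S₂ (m - N)
      with hS
    have hlast : S (2 ^ (k + 1) - 1) = S₁ (N - 1) + E.indicator r + S₂ (N - 1) := by
      simp only [hS]
      rw [if_neg (by omega), show 2 ^ (k + 1) - 1 - N = N - 1 by omega]
    have hSi₁ : Integrable (S₁ (N - 1)) muUnit := (h₁.memLp _).integrable one_le_two
    have hSi₂ : Integrable (S₂ (N - 1)) muUnit := (h₂.memLp _).integrable one_le_two
    have hm : ∀ m, MemLp (S m) 2 muUnit := fun m => by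
      by_cases h : m < N
      · simpa only [hS, if_pos h] using h₁.memLp m
      · simpa only [hS, if_neg h] using ((h₁.memLp _).add hr).add (h₂.memLp _)
    have hc₁ : ∀ m < N, phiPolynomial Φ c (G₁ m) = phiPolynomial Φ c₁ (G₁ m) := fun m hmN =>
      phiPolynomial_congr fun j hj => if_pos (h₁.monotone (by omega : m ≤ N - 1) hj)
    have hcB : phiPolynomial Φ c B = phiPolynomial Φ b B :=
      phiPolynomial_congr fun j hj => by
        simp only [hc]
        rw [if_neg (Finset.disjoint_right.1 (hG₁ (N - 1)).2 hj), if_pos hj]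
    have hc₂ : ∀ m, phiPolynomial Φ c (G₂ m) = phiPolynomial Φ c₂ (G₂ m) := fun m =>
      phiPolynomial_congr fun j hj => by
        simp only [hc]
        rw [if_neg (Finset.disjoint_left.1 (hG₂ m).2 hj),
          if_neg (Finset.disjoint_left.1 (hG₂ m).1.2 hj)]
    -- `T` counts the levels at which a point receives the sign +1.
    refine ⟨G, c, S, T₁ + T₂ + E₂.indicator 1, ?_, ?_, hm, ?_, ?_, ?_, ?_, ?_, ?_, ?_, ?_⟩
    · intro m m' hmm
      simp only [hG]
      split_ifs with h h' h'
      · exact h₁.monotone hmm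
      · exact (h₁.monotone (by omega : m ≤ N - 1)).trans
          (Finset.subset_union_left.trans Finset.subset_union_left)
      · omega
      · exact Finset.union_subset_union_right (h₂.monotone (by omega))
    · intro m
      simp only [hG]
      split_ifs
      · exact (hG₁ m).1
      · exact Finset.disjoint_union_left.2
          ⟨Finset.disjoint_union_left.2 ⟨(hG₁ _).1, hBF⟩, (hG₂ _).1.1⟩
    · intro m
      by_cases h : m < N
      · have e1 : G m = G₁ m := if_pos h
        have e2 : S m = S₁ m := if_pos h
        simp only [e1, e2, hc₁ m h]
        exact (h₁.near m).trans (by linarith)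
      · have e1 : G m = G₁ (N - 1) ∪ B ∪ G₂ (m - N) := if_neg h
        have e2 : S m = S₁ (N - 1) + E.indicator r + S₂ (m - N) := if_neg h
        have e3 : (hm m).toLp (S m) = (h₁.memLp (N - 1)).toLp _ + hr.toLp _
            + (h₂.memLp (m - N)).toLp _ := by
          simp only [e2]
          rfl
        rw [e1, e3, phiPolynomial_union, phiPolynomial_union (hG₁ _).2, hc₁ _ (by omega), hcB,
          hc₂, add_sub_add_comm, add_sub_add_comm]
        · refine (norm_add₃_le).trans ?_
          linarith [h₁.near (N - 1), h₂.near (m - N)]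
        · exact Finset.disjoint_union_left.2 ⟨(hG₂ _).2.symm, (hG₂ _).1.2.symm⟩
    · intro m x hx
      have hx₁ : x ∉ E₁ := fun h => hx h.1
      have hx₂ : x ∉ E₂ := fun h => hx h.1
      simp only [hS]
      split_ifs
      · exact h₁.eq_zero m x hx₁
      · simp [h₁.eq_zero _ x hx₁, h₂.eq_zero _ x hx₂, hx]
    · exact (h₁.integrable.add h₂.integrable).add (hone hE₂)
    · intro x hx
      have hx₁ : x ∉ E₁ := fun h => hx h.1
      have hx₂ : x ∉ E₂ := fun h => hx h.1
      simp [h₁.eq_zero' x hx₁, h₂.eq_zero' x hx₂, hx₂]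
    · intro x hx
      rcases hcase x with ⟨a, -⟩ | ⟨-, a, b, -⟩ | ⟨-, a, b, d⟩
      · exact absurd hx a
      · obtain ⟨m, hmN, hmx⟩ := h₁.le x a
        refine ⟨m, by omega, ?_⟩
        simp only [hS]
        rw [if_pos hmN]
        simpa [h₂.eq_zero' x b, b] using hmx
      · obtain ⟨m, hmN, hmx⟩ := h₂.le x b
        refine ⟨N + m, by omega, ?_⟩
        simp only [hS]
        rw [if_neg (by omega), Nat.add_sub_cancel_left]
        simp only [Pi.add_apply, h₁.eq_zero' x a, h₁.eq_zero _ x a, Set.indicator_of_mem hx,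
          Set.indicator_of_mem b, d, Pi.one_apply]
        linarith
    · rw [integral_add' (h₁.integrable.add h₂.integrable) (hone hE₂),
        integral_add' h₁.integrable h₂.integrable, integral_indicator_one hE₂]
      have a₁ := h₁.le_integral
      have a₂ := h₂.le_integral
      have := (abs_le.1 hint).1
      have e : (k : ℝ) / 2 * muUnit.real E₁ + k / 2 * muUnit.real E₂ = k / 2 * muUnit.real E := by
        rw [← mul_add, hsum]
      push_cast
      linarith
    · rw [hlast, integral_add' (hSi₁.add hri) hSi₂, integral_add' hSi₁ hri]
      refine (abs_add_three _ _ _).trans ?_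
      linarith [h₁.abs_integral_le, h₂.abs_integral_le]
    -- Since `S₁`, `S₂` live where r is -1, +1, the cross terms become linear. Hence the recursion
    -- must also control the integral of the last `S`.
    · have e : (fun x => S (2 ^ (k + 1) - 1) x ^ 2) = (fun x => S₁ (N - 1) x ^ 2)
          + (fun x => S₂ (N - 1) x ^ 2) + E.indicator 1 + (fun x => 2 * S₂ (N - 1) x)
          - (fun x => 2 * S₁ (N - 1) x) := by
        ext x
        rw [hlast]
        rcases hcase x with ⟨a, b, c⟩ | ⟨a, b, c, d⟩ | ⟨a, b, c, d⟩
        · simp [h₁.eq_zero _ x b, h₂.eq_zero _ x c, a]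
        · simp [h₂.eq_zero _ x c, a, d]; ring
        · simp [h₁.eq_zero _ x b, a, d]; ring
      have i₁ := (h₁.memLp (N - 1)).integrable_sq
      have i₂ := (h₂.memLp (N - 1)).integrable_sq
      have i₃ := hone hE
      rw [e, integral_sub' (((i₁.add i₂).add i₃).add (hSi₂.const_mul 2)) (hSi₁.const_mul 2),
        integral_add' ((i₁.add i₂).add i₃) (hSi₂.const_mul 2), integral_add' (i₁.add i₂) i₃,
        integral_add' i₁ i₂, integral_const_mul, integral_const_mul, integral_indicator_one hE]
      have e' : (k : ℝ) * muUnit.real E₁ + k * muUnit.real E₂ = k * muUnit.real E := by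
        rw [← mul_add, hsum]
      push_cast
      linarith [h₁.integral_sq_le, h₂.integral_sq_le, (abs_le.1 h₁.abs_integral_le).1,
        (abs_le.1 h₂.abs_integral_le).2]

/-! ### From the construction to the lower bound for `kappa` -/

/-- The `L¹` norm of a function dominated by the maximum of the `S m` is at most the `L²` norm of
the maximal function of nearby functions `p m`, up to the errors. -/
lemma ofReal_integral_le_eLpNorm_maximalFunction {N n : ℕ} (hNn : N ≤ n) {S : ℕ → ℝ → ℝ}
    {T : ℝ → ℝ} (hS : ∀ m, MemLp (S m) 2 muUnit) (hT : Integrable T muUnit)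
    (hle : ∀ x ∈ Set.Ioo (0 : ℝ) 1, ∃ m < N, T x ≤ S m x) {p : ℕ → L2Unit} {ε : ℝ}
    (hp : ∀ m < N, ‖p (m + 1) - (hS m).toLp (S m)‖ ≤ ε) :
    ENNReal.ofReal (∫ x, T x ∂muUnit) ≤
      eLpNorm (maximalFunction n fun m => p m) 2 muUnit + N * ENNReal.ofReal ε := by
  have hmeas : AEStronglyMeasurable (maximalFunction n fun m => p m) muUnit := by
    refine Measurable.aestronglyMeasurable ?_
    unfold maximalFunction
    refine Measurable.iSup fun m => Measurable.iSup fun _ => ?_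
    exact (Lp.stronglyMeasurable (p m)).measurable.enorm
  -- The good index depends on x, so all `N` errors are summed.
  have hpt : ∀ᵐ x ∂muUnit, ENNReal.ofReal (T x) ≤ maximalFunction n (fun m => p m) x
      + ∑ m ∈ Finset.range N, ‖(p (m + 1) - (hS m).toLp (S m) : L2Unit) x‖ₑ := by
    have h1 : ∀ᵐ x ∂muUnit, ∀ m, (p (m + 1) - (hS m).toLp (S m) : L2Unit) x
        = p (m + 1) x - S m x := by
      refine ae_all_iff.2 fun m => ?_
      filter_upwards [Lp.coeFn_sub (p (m + 1)) ((hS m).toLp (S m)), (hS m).coeFn_toLp] with x a b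
      rw [a, Pi.sub_apply, b]
    filter_upwards [h1, ae_restrict_mem measurableSet_Ioo] with x hx hx1
    obtain ⟨m, hmN, hmx⟩ := hle x hx1
    calc ENNReal.ofReal (T x) ≤ ENNReal.ofReal ‖S m x‖ :=
          ENNReal.ofReal_le_ofReal (hmx.trans (Real.le_norm_self _))
      _ = ‖p (m + 1) x - (p (m + 1) - (hS m).toLp (S m) : L2Unit) x‖ₑ := by
          rw [ofReal_norm, hx m, sub_sub_cancel]
      _ ≤ ‖p (m + 1) x‖ₑ + ‖(p (m + 1) - (hS m).toLp (S m) : L2Unit) x‖ₑ := enorm_sub_le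
      _ ≤ _ := by
          refine add_le_add ?_ ?_
          · exact le_iSup₂_of_le (f := fun m (_ : m ∈ Finset.Icc 1 n) => ‖p m x‖ₑ) (m + 1)
              (Finset.mem_Icc.2 ⟨by omega, by omega⟩) le_rfl
          · exact Finset.single_le_sum
              (f := fun m => ‖(p (m + 1) - (hS m).toLp (S m) : L2Unit) x‖ₑ)
              (fun _ _ => zero_le) (Finset.mem_range.2 hmN)
  calc ENNReal.ofReal (∫ x, T x ∂muUnit)
      ≤ ENNReal.ofReal (∫ x, max (T x) 0 ∂muUnit) :=
        ENNReal.ofReal_le_ofReal (integral_mono hT hT.pos_part fun x => le_max_left _ _)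
    _ = ∫⁻ x, ENNReal.ofReal (T x) ∂muUnit := by
        rw [ofReal_integral_eq_lintegral_ofReal hT.pos_part
          (Filter.Eventually.of_forall fun x => le_max_right _ _)]
        simp [ENNReal.ofReal_max]
    _ ≤ ∫⁻ x, (maximalFunction n (fun m => p m) x
          + ∑ m ∈ Finset.range N, ‖(p (m + 1) - (hS m).toLp (S m) : L2Unit) x‖ₑ) ∂muUnit :=
        lintegral_mono_ae hpt
    _ = eLpNorm (maximalFunction n fun m => p m) 1 muUnit
          + ∑ m ∈ Finset.range N, eLpNorm (p (m + 1) - (hS m).toLp (S m) : L2Unit) 1 muUnit := by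
        rw [lintegral_add_right _ (Finset.measurable_sum _ fun m _ =>
            (Lp.stronglyMeasurable _).measurable.enorm),
          lintegral_finsetSum _ fun m _ => (Lp.stronglyMeasurable _).measurable.enorm]
        simp [eLpNorm_one_eq_lintegral_enorm]
    _ ≤ eLpNorm (maximalFunction n fun m => p m) 2 muUnit
          + ∑ m ∈ Finset.range N, ENNReal.ofReal ε := by
        refine add_le_add (eLpNorm_le_eLpNorm_of_exponent_le one_le_two hmeas)
          (Finset.sum_le_sum fun m hm => ?_)
        refine (eLpNorm_le_eLpNorm_of_exponent_le one_le_two (Lp.aestronglyMeasurable _)).trans ?_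
        rw [← Lp.enorm_def, ← ofReal_norm]
        exact ENNReal.ofReal_le_ofReal (hp m (Finset.mem_range.1 hm))
    _ = _ := by simp

/-- A lower bound for `κ_n` of a complete system, for `n` at least a positive power of two. -/
theorem IsCompleteOrthonormalSystem.le_kappa {Φ : ℕ → L2Unit}
    (hΦ : IsCompleteOrthonormalSystem Φ) {k n : ℕ} (hk : 1 ≤ k) (hkn : 2 ^ k ≤ n) :
    ENNReal.ofReal (√k / 8) ≤ kappa n Φ := by
  set N := 2 ^ k
  have hN1 : 1 ≤ N := Nat.one_le_two_pow
  have hN : (1 : ℝ) ≤ N := by exact_mod_cast hN1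
  have hk1 : (1 : ℝ) ≤ k := by exact_mod_cast hk
  -- The `N` approximation errors then total 1/8.
  set ε : ℝ := 1 / (8 * N)
  have hε : 0 < ε := by positivity
  have hNε : N * ε = 1 / 8 := by simp only [ε]; field_simp
  have hε8 : ε ≤ 1 / 8 := by nlinarith
  obtain ⟨G₀, c, S, T, h⟩ := hΦ.exists_isSpreadSequence k (E := Set.Ioo (0 : ℝ) 1)
    measurableSet_Ioo ∅ hε
  have hE : muUnit.real (Set.Ioo (0 : ℝ) 1) = 1 := by simp [Measure.real]
  -- Indices shift from 0, …, N - 1 to 1, …, N; the sequence is constant from N to n.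
  set G : ℕ → Finset ℕ := fun m => G₀ (min (m - 1) (N - 1)) with hG
  have hmono : Monotone G := fun a b hab => h.monotone (by omega)
  have hGn : G n = G₀ (N - 1) := by simp only [hG]; congr 1; omega
  set M := eLpNorm (maximalFunction n fun m => phiPolynomial Φ c (G m)) 2 muUnit with hM
  have hlow : ENNReal.ofReal (k / 4) ≤ M := by
    have h1 := ofReal_integral_le_eLpNorm_maximalFunction (n := n) (N := N) hkn h.memLp
      h.integrable h.le (p := fun m => phiPolynomial Φ c (G m)) (ε := ε) fun m hm => by
        have : G (m + 1) = G₀ m := by simp only [hG]; congr 1; omega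
        rw [this]
        exact h.near m
    have h2 := h.le_integral
    rw [hE] at h2
    have e : (N : ℝ≥0∞) * ENNReal.ofReal ε = ENNReal.ofReal (1 / 8) := by
      rw [← hNε, ENNReal.ofReal_mul (by positivity), ENNReal.ofReal_natCast]
    rw [e] at h1
    have h3 : ENNReal.ofReal (k / 4) + ENNReal.ofReal (1 / 8) ≤ M + ENNReal.ofReal (1 / 8) := by
      refine le_trans ?_ h1
      rw [← ENNReal.ofReal_add (by positivity) (by positivity)]
      exact ENNReal.ofReal_le_ofReal (by linarith)
    exact (ENNReal.add_le_add_iff_right ENNReal.ofReal_ne_top).1 h3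
  have hup : eLpNorm (phiPolynomial Φ c (G n)) 2 muUnit ≤ ENNReal.ofReal (2 * √k) := by
    rw [← Lp.enorm_def, ← ofReal_norm]
    refine ENNReal.ofReal_le_ofReal ?_
    have h1 := h.near (N - 1)
    rw [← hGn] at h1
    have h2 := norm_le_norm_add_norm_sub' (phiPolynomial Φ c (G n)) ((h.memLp (N - 1)).toLp _)
    have h3 : ‖(h.memLp (N - 1)).toLp _‖ ^ 2 ≤ k + ε := by
      rw [← real_inner_self_eq_norm_sq, inner_toLp_toLp]
      have := h.integral_sq_le
      rw [hE, mul_one] at this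
      simpa only [sq] using this
    have hs := Real.sq_sqrt (Nat.cast_nonneg (α := ℝ) k)
    have hs1 : 1 ≤ √(k : ℝ) := Real.one_le_sqrt.2 hk1
    have h4 : ‖(h.memLp (N - 1)).toLp _‖ ≤ √k + 1 / 8 :=
      abs_le_of_sq_le_sq' (by nlinarith) (by positivity) |>.2
    linarith
  -- Vanishing coefficients would make the maximal function zero, against `hlow`.
  have hdata : IsMonotonicData n G c := by
    refine ⟨hmono.monotoneOn _, fun h0 => ?_⟩
    have hc : ∀ j ∈ G n, c j = 0 := fun j hj =>
      pow_eq_zero_iff two_ne_zero |>.1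
        ((Finset.sum_eq_zero_iff_of_nonneg fun j _ => sq_nonneg (c j)).1 h0 j hj)
    have hp : ∀ m, phiPolynomial Φ c (G m) = 0 := fun m =>
      Finset.sum_eq_zero fun j hj => by
        have : G m ⊆ G n := by rw [hGn]; exact h.monotone (by omega)
        rw [hc j (this hj), zero_smul]
    have hM0 : M = 0 := by
      rw [hM]
      refine (eLpNorm_congr_ae ?_).trans eLpNorm_zero
      filter_upwards [Lp.coeFn_zero ℝ 2 muUnit] with x hx
      simp [maximalFunction, hp]
    rw [hM0] at hlow
    have := ENNReal.ofReal_eq_zero.1 (le_zero_iff.1 hlow)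
    linarith
  have hs0 : 0 < √(k : ℝ) := by positivity
  calc ENNReal.ofReal (√k / 8) = ENNReal.ofReal (k / 4) / ENNReal.ofReal (2 * √k) := by
        rw [← ENNReal.ofReal_div_of_pos (by positivity)]
        congr 1
        rw [eq_div_iff (by positivity)]
        linarith [Real.mul_self_sqrt (Nat.cast_nonneg (α := ℝ) k)]
    _ ≤ M / eLpNorm (phiPolynomial Φ c (G n)) 2 muUnit := ENNReal.div_le_div hlow hup
    _ ≤ kappa n Φ := le_iSup_of_le G (le_iSup_of_le c (le_iSup_of_le hdata le_rfl))

theorem mainTheorem3 :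
    ∃ C : ℝ, 0 < C ∧
      ∀ Φ : ℕ → L2Unit, IsCompleteOrthonormalSystem Φ →
        ∀ n : ℕ, 1 ≤ n →
          ENNReal.ofReal (C * Real.sqrt (Real.logb 2 n)) ≤ kappa n Φ := by
  refine ⟨1 / 16, by norm_num, fun Φ hΦ n hn => ?_⟩
  rcases hn.eq_or_lt with rfl | hn
  · simp
  have hk : 1 ≤ Nat.log 2 n := Nat.log_pos one_lt_two hn
  refine le_trans (ENNReal.ofReal_le_ofReal ?_)
    (hΦ.le_kappa hk (Nat.pow_log_le_self 2 (by omega)))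
  have hk1 : (1 : ℝ) ≤ Nat.log 2 n := by exact_mod_cast hk
  have h1 : Real.logb 2 n ≤ Nat.log 2 n + 1 := by
    rw [Real.logb_le_iff_le_rpow one_lt_two (by positivity)]
    exact_mod_cast (Nat.lt_pow_succ_log_self one_lt_two n).le
  -- Rounding the logarithm down costs a factor 2, turning 1/8 into 1/16.
  have h2 : √(Real.logb 2 n) ≤ 2 * √(Nat.log 2 n) := by
    rw [Real.sqrt_le_left (by positivity), mul_pow, Real.sq_sqrt (by positivity)]
    linarith
  linarith
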